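/- **Theorem (tree metrics).** Let $V$ be a finite data set of size $n\ge 3$. A metric $\rho$ on $V$ is a *tree metric* if there are a finite tree $T$ with nonnegative edge weights and a bijection $l$ from $V$ to the leaves (vertices of degree one) of $T$ such that $\rho(u,v)$ is, for all $u,v\in V$, the sum of the weights along the path from $l(u)$ to $l(v)$ in $T$. A labeled sample is a triple $(x,y^+,z^-)$ of distinct points of $V$. A classifier assigns to each unlabeled query $(x,\{y,z\})$ at most one of the labels $(x,y^+,z^-)$ and $(x,z^+,y^-)$, and its error rate under a distribution $\mathcal D$ of labeled samples is the probability that a sample from $\mathcal D$ does not carry the label assigned to its query. A metric $\rho$ gives the classifier that answers $(x,y^+,z^-)$ exactly if $\rho(x,y)<\rho(x,z)$. Let $\mathcal H$ be the class of the classifiers of all tree metrics on $V$, and let $\varepsilon^*=\varepsilon^*(\mathcal D)$ be the smallest error rate under $\mathcal D$ of a member of $\mathcal H$. The agnostic sample complexity $S^a(\varepsilon,\delta)$ is the least $m$ for which there is a learner, i.e. a map from $m$-tuples of labeled samples to classifiers, such that for every $\mathcal D$, given $m$ independent samples from $\mathcal D$, it outputs with probability at least $1-\delta$ a classifier with error rate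 at most $\varepsilon^*+\varepsilon$. The realizable sample complexity $S(\varepsilon,\delta)$ is defined in the same way, with only those $\mathcal D$ for which some member of $\mathcal H$ has error rate $0$. Then there are absolute constants $C,c,\varepsilon_0,\delta_0>0$ and $k\in\mathbb N$ such that, for all such $V$ and all $\varepsilon,\delta\in(0,1)$, both sample complexities exist and $$S(\varepsilon,\delta)\le C\,\frac{n\log n}{\varepsilon}\Bigl(1+\log\frac1\varepsilon+\log\frac1\delta\Bigr)^k,\qquad S^a(\varepsilon,\delta)\le C\,\frac{n\log n}{\varepsilon^2}\Bigl(1+\log\frac1\varepsilon+\log\frac1\delta\Bigr)^k,$$ and, if moreover $\varepsilon\le\varepsilon_0$ and $\delta\le\delta_0$, $$S(\varepsilon,\delta)\ge c\,\frac{n}{\varepsilon},\qquad S^a(\varepsilon,\delta)\ge c\,\frac{n}{\varepsilon^2}.$$ The same holds, with the same constants, if the learner is required to output a member of $\mathcal H$, or a member of any fixed set of classifiers that contains $\mathcal H$. -/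

import Mathlib

open MeasureTheory

namespace TreeContrastive

/-- A labeled contrastive sample `(x, y⁺, z⁻)` on the data set `V`: three distinct points, an anchor
`x`, a positive example `y` and a negative example `z`. -/
@[ext]
structure LabeledTriple (V : Type*) where
  anchor : V
  pos : V
  neg : V
  anchor_ne_pos : anchor ≠ pos
  anchor_ne_neg : anchor ≠ neg
  pos_ne_neg : pos ≠ neg

/-- Data sets are finite: every set of labeled triples is an event. -/
instance (V : Type*) : MeasurableSpace (LabeledTriple V) := ⊤

/-- The other labeling `(x, z⁺, y⁻)` of the unlabeled query underlying `(x, y⁺, z⁻)`. -/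
def LabeledTriple.swap {V : Type*} (t : LabeledTriple V) : LabeledTriple V where
  anchor := t.anchor
  pos := t.neg
  neg := t.pos
  anchor_ne_pos := t.anchor_ne_neg
  anchor_ne_neg := t.anchor_ne_pos
  pos_ne_neg := t.pos_ne_neg.symm

/-- A classifier assigns to each unlabeled query `(x, {y, z})` at most one of its two labelings;
`accepts` is the set of labeled triples that it outputs. A query to which it assigns no label
counts as an error. -/
structure Classifier (V : Type*) where
  accepts : Set (LabeledTriple V)
  swap_notMem : ∀ t ∈ accepts, t.swap ∉ accepts

/-- The classifier of a distance function `ρ`: the query `(x, {y, z})` is labeled `(x, y⁺, z⁻)`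
exactly if `ρ x y < ρ x z`. -/
def classifierOf {V : Type*} (ρ : V → V → ℝ) : Classifier V where
  accepts := {t | ρ t.anchor t.pos < ρ t.anchor t.neg}
  swap_notMem := fun t (ht : ρ t.anchor t.pos < ρ t.anchor t.neg)
    (hs : ρ t.anchor t.neg < ρ t.anchor t.pos) => lt_asymm ht hs

/-- The error rate of the classifier `c` when labeled samples are drawn from `D`. -/
noncomputable def errorRate {V : Type*} (D : Measure (LabeledTriple V)) (c : Classifier V) : ℝ :=
  D.real {t | t ∉ c.accepts}

/-- The smallest error rate over a hypothesis class. -/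
noncomputable def bestErrorRate {V : Type*} (D : Measure (LabeledTriple V))
    (H : Set (Classifier V)) : ℝ :=
  sInf (errorRate D '' H)

/-- The learner `A` which outputs a classifier from `m` labeled samples succeeds on `D`: on `m`
independent samples from `D`, with probability at least `1 - δ`, the output has error rate at
most `ε` more than the smallest error rate over `H`. -/
def Succeeds {V : Type*} (H : Set (Classifier V)) (ε δ : ℝ) {m : ℕ}
    (A : (Fin m → LabeledTriple V) → Classifier V) (D : Measure (LabeledTriple V)) : Prop :=
  1 - δ ≤ (Measure.pi fun _ : Fin m => D).real
    {s | errorRate D (A s) ≤ bestErrorRate D H + ε}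

/-- The distribution `D` is realizable by `H`: some hypothesis has error rate zero. -/
def Realizable {V : Type*} (H : Set (Classifier V)) (D : Measure (LabeledTriple V)) : Prop :=
  ∃ h ∈ H, errorRate D h = 0

/-- `m` labeled samples suffice in the agnostic case, with hypothesis class `H` and with `O` the
set of classifiers that the learner may output. -/
def SufficesAgnostic {V : Type*} (H O : Set (Classifier V)) (ε δ : ℝ) (m : ℕ) : Prop :=
  ∃ A : (Fin m → LabeledTriple V) → Classifier V, (∀ s, A s ∈ O) ∧
    ∀ D : Measure (LabeledTriple V), IsProbabilityMeasure D → Succeeds H ε δ A D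

/-- `m` labeled samples suffice in the realizable case, with hypothesis class `H` and with `O` the
set of classifiers that the learner may output. -/
def SufficesRealizable {V : Type*} (H O : Set (Classifier V)) (ε δ : ℝ) (m : ℕ) : Prop :=
  ∃ A : (Fin m → LabeledTriple V) → Classifier V, (∀ s, A s ∈ O) ∧
    ∀ D : Measure (LabeledTriple V), IsProbabilityMeasure D → Realizable H D → Succeeds H ε δ A D

/-- `m` is the sample complexity in the agnostic case: the least sufficient number of samples. -/
def IsAgnosticSampleComplexity {V : Type*} (H O : Set (Classifier V)) (ε δ : ℝ) (m : ℕ) : Prop :=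
  IsLeast {m | SufficesAgnostic H O ε δ m} m

/-- `m` is the sample complexity in the realizable case: the least sufficient number of samples. -/
def IsRealizableSampleComplexity {V : Type*} (H O : Set (Classifier V)) (ε δ : ℝ) (m : ℕ) : Prop :=
  IsLeast {m | SufficesRealizable H O ε δ m} m

/-- `ρ` is a metric on `V`. -/
structure IsMetric {V : Type*} (ρ : V → V → ℝ) : Prop where
  eq_zero_iff : ∀ u v, ρ u v = 0 ↔ u = v
  symm : ∀ u v, ρ u v = ρ v u
  triangle : ∀ u v w, ρ u w ≤ ρ u v + ρ v w

/-- `ρ` is a tree metric on `V`: a metric for which there are a finite tree `T` with nonnegative edge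
weights and a bijection `l` from `V` to the leaves (the vertices of degree one) of `T`, such that
`ρ u v` is the sum of the weights along the unique path from `l u` to `l v`. -/
def IsTreeMetric {V : Type*} (ρ : V → V → ℝ) : Prop :=
  IsMetric ρ ∧
  ∃ (N : ℕ) (T : SimpleGraph (Fin N)) (wt : Sym2 (Fin N) → ℝ)
    (l : V ≃ {a : Fin N // (T.neighborSet a).ncard = 1}),
    T.IsTree ∧ (∀ e ∈ T.edgeSet, 0 ≤ wt e) ∧
    ∀ u v : V, ∃ p : T.Walk (l u : Fin N) (l v : Fin N),
      p.IsPath ∧ ρ u v = (p.edges.map wt).sum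

/-- The hypothesis class of contrastive learning for tree metrics on `V`. -/
def treeClass (V : Type*) : Set (Classifier V) :=
  {c | ∃ ρ : V → V → ℝ, IsTreeMetric ρ ∧ c = classifierOf ρ}

end TreeContrastive

/-! Upper bounds: `treeClass V` is finite with `log |treeClass V| ≤ 11 n log n`
(`log_ncard_treeClass_le`), so minimizing the empirical error and a union bound suffice. For the
count, root the tree anywhere. Then `ρ u v = S u + S v - 2 * g u v`, where `S` is the depth of a
leaf and `g` the depth of a branching point, and `g` is a reversed ultrametric
(`IsTreeMetric.exists_depth`). Off the diagonal `g` takes only `n` parameters `a k` as values. A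
predecessor map `p` and the order of the `a k` decide which one occurs at which pair. Hence a
classifier is determined by `p`, with `n ^ n` choices, and by the signs of `n ^ 4` linear forms in
the `2 * n` unknowns `(S, a)`. A linear family of dimension `D` has VC dimension at most `D`, so
Sauer–Shelah leaves at most `(n ^ 4 + 1) ^ (2 * n)` sign patterns.

Lower bounds: seen from one leaf of a star, about `n / 2` disjoint pairs of other leaves can be
ordered independently (`isShattered_pairQueries`). Assouad's lemma (`exists_parameter_many_errors`),
applied to distributions that favour the labels `σ`, shows that few samples leave a constant
fraction of `σ` undetermined. Noiseless labels on queries of total mass of order `ε` give `n / ε`;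
labels of bias of order `ε` on queries of full mass give `n / ε ^ 2`. -/

namespace TreeContrastive

/-! ### Depths and branching points in a weighted tree. -/

section Trees

variable {α : Type*} {T : SimpleGraph α}

/-- Two paths of an acyclic graph which start at the same vertex have a common initial segment, and
the remaining segments form a path. -/
lemma exists_common_initial_segment (hT : T.IsAcyclic) {r u v : α} (p : T.Walk r u)
    (q : T.Walk r v) (hp : p.IsPath) (hq : q.IsPath) :
    ∃ (A B C : List (Sym2 α)) (w : T.Walk u v), w.IsPath ∧ p.edges = A ++ B ∧ q.edges = A ++ C ∧
      w.edges = B.reverse ++ C := by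
  induction p with
  | nil => exact ⟨[], [], q.edges, q, hq, by simp⟩
  | @cons r x u h p ih =>
    cases q with
    | nil => exact ⟨[], (SimpleGraph.Walk.cons h p).edges, [], (SimpleGraph.Walk.cons h p).reverse,
      hp.reverse, rfl, rfl, by rw [SimpleGraph.Walk.edges_reverse, List.append_nil]⟩
    | @cons _ y _ h' q =>
      by_cases hxy : x = y
      · subst hxy
        obtain ⟨A, B, C, w, hw, h1, h2, h3⟩ := ih q hp.of_cons hq.of_cons
        exact ⟨s(r, x) :: A, B, C, w, hw, by simp [h1], by simp [h2], h3⟩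
      · refine ⟨[], (SimpleGraph.Walk.cons h p).edges, (SimpleGraph.Walk.cons h' q).edges,
          (SimpleGraph.Walk.cons h p).reverse.append (.cons h' q), ?_, rfl, rfl, by rw [SimpleGraph.Walk.edges_append, SimpleGraph.Walk.edges_reverse]⟩
        -- In an acyclic graph a walk is a path once consecutive edges differ, so only the junction
        -- at `r` needs checking.
        rw [hT.isPath_iff_isChain] at hp hq ⊢
        rw [SimpleGraph.Walk.edges_append, SimpleGraph.Walk.edges_reverse]
        refine List.IsChain.append ?_ hq ?_
        · rw [List.isChain_reverse]
          exact hp.imp fun _ _ h => h.symm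
        · intro a ha b hb
          simp at ha hb
          subst ha hb
          simp only [ne_eq, Sym2.eq_iff, true_and, not_or, not_and]
          exact ⟨hxy, fun h1 h2 => hxy (h2.trans h1)⟩

lemma sum_map_le_of_prefix {E : Type*} {f : E → ℝ} {A B : List E} (h : A <+: B)
    (hf : ∀ e ∈ B, 0 ≤ f e) : (A.map f).sum ≤ (B.map f).sum := by
  obtain ⟨C, rfl⟩ := h
  rw [List.map_append, List.sum_append, le_add_iff_nonneg_right]
  refine List.sum_nonneg fun x hx => ?_
  obtain ⟨e, he, rfl⟩ := List.mem_map.1 hx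
  exact hf e (List.mem_append_right _ he)

/-- If `D` went beyond `A`, its next entry would lie in both `B` and `C`. -/
lemma prefix_of_common_prefix {E : Type*} {A B C D : List E} (hd : (B.reverse ++ C).Nodup)
    (h1 : D <+: A ++ B) (h2 : D <+: A ++ C) : D <+: A := by
  rcases List.prefix_or_prefix_of_prefix h1 (List.prefix_append A B) with h | ⟨F, rfl⟩
  · exact h
  · rw [List.prefix_append_right_inj] at h1 h2
    cases F with
    | nil => simp
    | cons e F =>
      exact absurd ((List.nodup_append.1 hd).2.2 e (List.mem_reverse.2 (h1.subset (by simp)))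
        e (h2.subset (by simp))) (by simp)

end Trees

/-- A tree metric is determined by the depths of the leaves and by the depths of the branching
points of pairs of leaves, and the latter satisfy the (reversed) ultrametric inequality. -/
lemma IsTreeMetric.exists_depth {V : Type*} {ρ : V → V → ℝ} (h : IsTreeMetric ρ) :
    ∃ (S : V → ℝ) (g : V → V → ℝ), (∀ u v, g u v = g v u) ∧
      (∀ u v, ρ u v = S u + S v - 2 * g u v) ∧ ∀ u v w, min (g u w) (g w v) ≤ g u v := by
  obtain ⟨hm, N, T, wt, l, hT, hwt, hρ⟩ := h
  obtain ⟨r⟩ := hT.connected.nonempty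
  choose p hp _ using fun a => hT.existsUnique_path r a
  have key : ∀ u v : V, ∃ A B C : List (Sym2 (Fin N)), (p (l u)).edges = A ++ B ∧
      (p (l v)).edges = A ++ C ∧ (B.reverse ++ C).Nodup ∧
      ρ u v = (B.map wt).sum + (C.map wt).sum := by
    intro u v
    obtain ⟨A, B, C, w, hw, h1, h2, h3⟩ :=
      exists_common_initial_segment hT.isAcyclic _ _ (hp (l u)) (hp (l v))
    obtain ⟨q, hq, hqs⟩ := hρ u v
    have : q = w := congrArg Subtype.val
      ((hT.isAcyclic.subsingleton_path _ _).elim (⟨q, hq⟩ : T.Path _ _) ⟨w, hw⟩)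
    refine ⟨A, B, C, h1, h2, h3 ▸ hw.isTrail.edges_nodup, ?_⟩
    rw [hqs, this, h3, List.map_append, List.sum_append, List.map_reverse, List.sum_reverse]
  choose A B C h1 h2 h3 h4 using key
  -- `A u v` is the longest common initial segment of the two root paths, and weights are
  -- nonnegative. This maximality yields both the symmetry and the ultrametric inequality.
  have hle : ∀ u v D, D <+: (p (l u)).edges → D <+: (p (l v)).edges →
      (D.map wt).sum ≤ ((A u v).map wt).sum := by
    intro u v D hu hv
    refine sum_map_le_of_prefix (prefix_of_common_prefix (h3 u v) (h1 u v ▸ hu) (h2 u v ▸ hv))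
      fun e he => hwt e ((p (l u)).edges_subset_edgeSet ?_)
    rw [h1 u v]
    exact List.mem_append_left _ he
  have hA1 : ∀ u v, A u v <+: (p (l u)).edges := fun u v => h1 u v ▸ List.prefix_append _ _
  have hA2 : ∀ u v, A u v <+: (p (l v)).edges := fun u v => h2 u v ▸ List.prefix_append _ _
  refine ⟨fun u => ((p (l u)).edges.map wt).sum, fun u v => ((A u v).map wt).sum, ?_, ?_, ?_⟩
  · exact fun u v => le_antisymm (hle v u _ (hA2 u v) (hA1 u v)) (hle u v _ (hA2 v u) (hA1 v u))
  · intro u v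
    have e1 : ((p (l u)).edges.map wt).sum = ((A u v).map wt).sum + ((B u v).map wt).sum := by
      rw [h1 u v, List.map_append, List.sum_append]
    have e2 : ((p (l v)).edges.map wt).sum = ((A u v).map wt).sum + ((C u v).map wt).sum := by
      rw [h2 u v, List.map_append, List.sum_append]
    dsimp only
    rw [h4, e1, e2]
    ring
  · intro u v w
    -- Both segments start the root path of `w`, so they are nested; the shorter one is common to
    -- `u` and `v`.
    rcases List.prefix_or_prefix_of_prefix (hA2 u w) (hA1 w v) with h | h
    · exact (min_le_left _ _).trans (hle u v _ (hA1 u w) (h.trans (hA2 w v)))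
    · exact (min_le_right _ _).trans (hle u v _ (h.trans (hA1 u w)) (hA2 w v))

/-! ### Sign patterns of linear families. -/

section SignPatterns

open Classical in
/-- The points at which a function is negative. -/
noncomputable def negSet {ι : Type*} [Fintype ι] (f : ι → ℝ) : Finset ι :=
  Finset.univ.filter fun i => f i < 0

lemma mem_negSet {ι : Type*} [Fintype ι] {f : ι → ℝ} {i : ι} : i ∈ negSet f ↔ f i < 0 := by
  simp [negSet]

/-- No set of more than `D` points is shattered by the sign patterns of a `D`-dimensional family of
functions. -/
lemma card_le_of_shatters_negSet {ι E : Type*} [Fintype ι] [DecidableEq ι] [AddCommGroup E]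
    [Module ℝ E] [Module.Finite ℝ E] (L : E →ₗ[ℝ] ι → ℝ) (s : Finset ι)
    (hs : ∀ t ⊆ s, ∃ x, s ∩ negSet (L x) = t) : s.card ≤ Module.finrank ℝ E := by
  by_contra! hlt
  let R : E →ₗ[ℝ] s → ℝ := (LinearMap.funLeft ℝ ℝ ((↑) : s → ι)).comp L
  have hne : LinearMap.range R ≠ ⊤ := by
    intro htop
    have h1 := LinearMap.finrank_range_le R
    rw [htop, finrank_top, Module.finrank_fintype_fun_eq_card, Fintype.card_coe] at h1
    omega
  -- The restriction to `s` is not onto, so a nonzero functional, with coefficients `c`, vanishes on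
  -- its range.
  obtain ⟨φ, hφ, hφR⟩ := Submodule.exists_le_ker_of_lt_top _ (lt_top_iff_ne_top.2 hne)
  let c : s → ℝ := fun i => φ (Pi.single i 1)
  have hφc : ∀ v, φ v = ∑ i, v i * c i := by
    intro v
    conv_lhs => rw [pi_eq_sum_univ' v]
    simp [c, Pi.single]
  have hzero : ∀ x, ∑ i : s, L x i * c i = 0 := by
    intro x
    have : φ (R x) = 0 := hφR (LinearMap.mem_range_self R x)
    rw [hφc] at this
    exact this
  -- By shattering, some `L x` is negative exactly where `c` is positive, so one positive
  -- coefficient makes the sum negative. Used for `c` and `-c`, this forces `c = 0`.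
  have hpos : ∀ (c : s → ℝ), (∀ x, ∑ i : s, L x i * c i = 0) → ∀ i, c i ≤ 0 := by
    intro c hc i
    by_contra! hi
    obtain ⟨x, hx⟩ := hs (s.filter fun j => ∃ hj : j ∈ s, 0 < c ⟨j, hj⟩) (Finset.filter_subset _ _)
    have hiff : ∀ j : s, L x j < 0 ↔ 0 < c j := by
      intro j
      have := Finset.ext_iff.1 hx j
      simpa [mem_negSet] using this
    have hneg : ∑ j : s, L x j * c j < 0 := by
      refine Finset.sum_neg' (fun j _ => ?_) ⟨i, Finset.mem_univ _, ?_⟩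
      · by_cases hj : 0 < c j
        · exact (mul_neg_of_neg_of_pos ((hiff j).2 hj) hj).le
        · exact mul_nonpos_of_nonneg_of_nonpos (not_lt.1 fun h => hj ((hiff j).1 h)) (not_lt.1 hj)
      · exact mul_neg_of_neg_of_pos ((hiff i).2 hi) hi
    exact hneg.ne (hc x)
  refine hφ (LinearMap.ext fun v => ?_)
  rw [hφc, LinearMap.zero_apply]
  refine Finset.sum_eq_zero fun i _ => ?_
  have h1 := hpos c hzero i
  have h2 := hpos (fun i => -c i) (fun x => by simpa using hzero x) i
  rw [le_antisymm h1 (by linarith), mul_zero]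

/-- Termwise comparison with the binomial expansion of `(M + 1) ^ D`. -/
lemma sum_choose_le_pow (M D : ℕ) : ∑ k ∈ Finset.Iic D, M.choose k ≤ (M + 1) ^ D := by
  have : Finset.Iic D = Finset.range (D + 1) := by ext; simp
  rw [add_pow, this]
  refine Finset.sum_le_sum fun k hk => ?_
  have h1 : M.choose k ≤ M ^ k := Nat.choose_le_pow M k
  have h2 : 0 < D.choose k := Nat.choose_pos (by simpa [Nat.lt_succ_iff] using hk)
  simpa using h1.trans (Nat.le_mul_of_pos_right _ h2)

/-- A `D`-dimensional family of functions on `M` points has at most `(M + 1) ^ D` sign patterns. -/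
lemma ncard_range_negSet_le {ι E : Type*} [Fintype ι] [AddCommGroup E]
    [Module ℝ E] [Module.Finite ℝ E] (L : E →ₗ[ℝ] ι → ℝ) :
    (Set.range fun x => negSet (L x)).ncard ≤ (Fintype.card ι + 1) ^ Module.finrank ℝ E := by
  classical
  let 𝒜 : Finset (Finset ι) := (Set.toFinite (Set.range fun x => negSet (L x))).toFinset
  have hvc : 𝒜.vcDim ≤ Module.finrank ℝ E := by
    refine Finset.sup_le fun s hs => ?_
    rw [Finset.mem_shatterer] at hs
    refine card_le_of_shatters_negSet L s fun t ht => ?_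
    obtain ⟨u, hu, hut⟩ := hs ht
    obtain ⟨x, rfl⟩ : ∃ x, negSet (L x) = u := by simpa [𝒜] using hu
    exact ⟨x, hut⟩
  -- Sauer–Shelah: a family has at most as many members as it shatters sets.
  calc (Set.range fun x => negSet (L x)).ncard = 𝒜.card := Set.ncard_eq_toFinset_card _ _
    _ ≤ _ := 𝒜.card_le_card_shatterer
    _ ≤ _ := Finset.card_shatterer_le_sum_vcDim
    _ ≤ ∑ k ∈ Finset.Iic (Module.finrank ℝ E), (Fintype.card ι).choose k :=
      Finset.sum_le_sum_of_subset (Finset.Iic_subset_Iic.2 hvc)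
    _ ≤ _ := sum_choose_le_pow _ _

end SignPatterns

/-! ### Counting the classifiers of tree metrics. -/

section Counting

/-- Inserting the points one after the other, a (reversed) ultrametric is recovered from the
nearest predecessor of each point and the value at it. -/
def GeneratedBy {n : ℕ} (p : Fin n → Fin n) (a : Fin n → ℝ) (g : Fin n → Fin n → ℝ) : Prop :=
  (∀ i j, g i j = g j i) ∧
  ∀ k j, j < k → p k < k ∧ g k (p k) = a k ∧ (j ≠ p k → g k j = min (a k) (g (p k) j))

/-- Let `p k` maximize `g k` among the predecessors of `k`. The ultrametric inequality for `k`, `p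
k`, `j` then leaves only `g k j = min (g k (p k)) (g (p k) j)`. The least point has no predecessor
and is unconstrained. -/
lemma exists_generatedBy {n : ℕ} (g : Fin n → Fin n → ℝ) (hs : ∀ i j, g i j = g j i)
    (hg : ∀ i j k, min (g i k) (g k j) ≤ g i j) : ∃ p a, GeneratedBy p a g := by
  have hp : ∀ k : Fin n, ∃ q : Fin n, ∀ j < k, q < k ∧ g k j ≤ g k q := by
    intro k
    by_cases hk : (Finset.Iio k).Nonempty
    · obtain ⟨q, hq, hmax⟩ := Finset.exists_max_image _ (g k) hk
      exact ⟨q, fun j hj => ⟨Finset.mem_Iio.1 hq, hmax j (Finset.mem_Iio.2 hj)⟩⟩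
    · exact ⟨k, fun j hj => absurd ⟨j, Finset.mem_Iio.2 hj⟩ hk⟩
  choose p hp using hp
  refine ⟨p, fun k => g k (p k), hs, fun k j hj => ⟨(hp k j hj).1, rfl, fun _ => le_antisymm ?_ ?_⟩⟩
  · refine le_min (hp k j hj).2 (le_trans (le_min ?_ le_rfl) (hg (p k) j k))
    rw [hs (p k) k]
    exact (hp k j hj).2
  · exact hg k j (p k)

/-- Unrolling the recursion, by induction on the larger point, expresses each off-diagonal value as
a minimum of parameters; the order of the parameters decides where it is attained. Diagonal values
are not controlled, nor needed, as the points of a triple are distinct. -/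
lemma GeneratedBy.exists_index {n : ℕ} {p : Fin n → Fin n} {a a' : Fin n → ℝ}
    {g g' : Fin n → Fin n → ℝ} (h : GeneratedBy p a g) (h' : GeneratedBy p a' g')
    (ha : ∀ i j, a i < a j ↔ a' i < a' j) (i j : Fin n) (hij : i ≠ j) :
    ∃ k, g i j = a k ∧ g' i j = a' k := by
  have main : ∀ (m : ℕ) (k : Fin n), (k : ℕ) = m → ∀ j < k,
      ∃ i, g k j = a i ∧ g' k j = a' i := by
    intro m
    induction m using Nat.strong_induction_on with
    | _ m ih =>
      intro k hk j hj
      obtain ⟨hpk, h1, h2⟩ := h.2 k j hj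
      obtain ⟨-, h1', h2'⟩ := h'.2 k j hj
      by_cases hjp : j = p k
      · subst hjp
        exact ⟨k, h1, h1'⟩
      · obtain ⟨i, hi, hi'⟩ : ∃ i, g (p k) j = a i ∧ g' (p k) j = a' i := by
          rcases lt_or_gt_of_ne hjp with hlt | hlt
          · exact ih (p k) (hk ▸ hpk) (p k) rfl j hlt
          · rw [h.1 (p k) j, h'.1 (p k) j]
            exact ih j (hk ▸ hj) j rfl (p k) hlt
        rw [h2 hjp, h2' hjp, hi, hi']
        by_cases hlt : a i < a k
        · exact ⟨i, min_eq_right hlt.le, min_eq_right ((ha i k).1 hlt).le⟩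
        · exact ⟨k, min_eq_left (not_lt.1 hlt),
            min_eq_left (not_lt.1 fun hc => hlt ((ha i k).2 hc))⟩
  rcases lt_or_gt_of_ne hij with hlt | hlt
  · rw [h.1 i j, h'.1 i j]
    exact main j j rfl i hlt
  · exact main i i rfl j hlt

/-- The linear forms in the depths which decide the comparisons of distances. -/
noncomputable def comparisonForms (n : ℕ) :
    ((Fin n → ℝ) × (Fin n → ℝ)) →ₗ[ℝ] (Fin n × Fin n) × (Fin n × Fin n) → ℝ where
  toFun x i := x.1 i.1.1 - x.1 i.1.2 - 2 * x.2 i.2.1 + 2 * x.2 i.2.2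
  map_add' x y := by ext; simp; ring
  map_smul' c x := by ext; simp; ring

/-- The depth of the anchor cancels when two distances from it are compared. -/
lemma exists_code {V : Type*} {n : ℕ} (e : V ≃ Fin n) {c : Classifier V} (hc : c ∈ treeClass V) :
    ∃ (p : Fin n → Fin n) (S a : Fin n → ℝ) (g : Fin n → Fin n → ℝ), GeneratedBy p a g ∧
      ∀ t, t ∈ c.accepts ↔ S (e t.pos) - 2 * g (e t.anchor) (e t.pos) <
        S (e t.neg) - 2 * g (e t.anchor) (e t.neg) := by
  obtain ⟨ρ, hρ, rfl⟩ := hc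
  obtain ⟨S, g, hs, hd, hg⟩ := hρ.exists_depth
  obtain ⟨p, a, h⟩ := exists_generatedBy (fun i j => g (e.symm i) (e.symm j))
    (fun i j => hs _ _) (fun i j k => hg _ _ _)
  refine ⟨p, fun i => S (e.symm i), a, _, h, fun t => ?_⟩
  change ρ _ _ < ρ _ _ ↔ _
  rw [hd, hd]
  simp only [Equiv.symm_apply_apply]
  constructor <;> intro <;> linarith

lemma ncard_treeClass_le_aux {V : Type*} {n : ℕ} (e : V ≃ Fin n) :
    (treeClass V).Finite ∧ (treeClass V).ncard ≤ n ^ n * (n * n * (n * n) + 1) ^ (n + n) := by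
  classical
  have : Nonempty (Fin n → Fin n) := ⟨id⟩
  choose! p S a g hgen hacc using fun c (hc : c ∈ treeClass V) => exists_code e hc
  let P := Set.range fun x => negSet (comparisonForms n x)
  let F : Classifier V → (Fin n → Fin n) × Finset ((Fin n × Fin n) × (Fin n × Fin n)) :=
    fun c => (p c, negSet (comparisonForms n (S c, a c)))
  have hF : Set.MapsTo F (treeClass V) (Set.univ ×ˢ P) := fun c _ => ⟨trivial, _, rfl⟩
  have hinj : Set.InjOn F (treeClass V) := by
    intro c hc c' hc' hcc
    have hp : p c = p c' := congrArg Prod.fst hcc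
    have hN : ∀ y z i j, S c y - S c z - 2 * a c i + 2 * a c j < 0 ↔
        S c' y - S c' z - 2 * a c' i + 2 * a c' j < 0 := fun y z i j => by
      have := Finset.ext_iff.1 (congrArg Prod.snd hcc) ((y, z), (i, j))
      simpa [F, mem_negSet, comparisonForms] using this
    have hgen' := hgen c' hc'
    rw [← hp] at hgen'
    -- On a repeated first pair the `S` terms cancel, so these forms already record the order of
    -- `a`.
    have hidx := (hgen c hc).exists_index hgen' fun i j => by
      have := hN i i j i
      constructor <;> intro h
      · linarith [this.1 (by linarith)]
      · linarith [this.2 (by linarith)]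
    have : c.accepts = c'.accepts := by
      ext t
      rw [hacc c hc, hacc c' hc']
      obtain ⟨i, hi, hi'⟩ := hidx (e t.anchor) (e t.pos) (e.injective.ne t.anchor_ne_pos)
      obtain ⟨j, hj, hj'⟩ := hidx (e t.anchor) (e t.neg) (e.injective.ne t.anchor_ne_neg)
      rw [hi, hi', hj, hj']
      have := hN (e t.pos) (e t.neg) i j
      constructor <;> intro h
      · linarith [this.1 (by linarith)]
      · linarith [this.2 (by linarith)]
    cases c
    cases c'
    simpa using this
  have hfin : (Set.univ ×ˢ P : Set ((Fin n → Fin n) × _)).Finite := Set.toFinite _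
  refine ⟨Set.Finite.of_finite_image (hfin.subset hF.image_subset) hinj, ?_⟩
  calc (treeClass V).ncard ≤ (Set.univ ×ˢ P : Set ((Fin n → Fin n) × _)).ncard :=
        Set.ncard_le_ncard_of_injOn F hF hinj hfin
    _ = n ^ n * P.ncard := by rw [Set.ncard_prod, Set.ncard_univ]; simp
    _ ≤ _ := by
      gcongr
      have := ncard_range_negSet_le (comparisonForms n)
      simpa using this

lemma finite_treeClass (V : Type*) [Fintype V] : (treeClass V).Finite :=
  (ncard_treeClass_le_aux (Fintype.equivFin V)).1

/-- Since `n ^ 4 + 1 ≤ n ^ 5` for `n ≥ 2`, the count is at most `n ^ (n + 5 * 2 * n)`, whence 11. -/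
lemma log_ncard_treeClass_le (V : Type*) [Fintype V] (hV : 2 ≤ Fintype.card V) :
    Real.log (treeClass V).ncard ≤ 11 * (Fintype.card V * Real.log (Fintype.card V)) := by
  have h := (ncard_treeClass_le_aux (Fintype.equivFin V)).2
  set n := Fintype.card V
  have hn : n * n * (n * n) + 1 ≤ n ^ 5 := by
    have : 1 ≤ n ^ 4 := Nat.one_le_pow _ _ (by omega)
    calc n * n * (n * n) + 1 ≤ n ^ 4 * 2 := by nlinarith
      _ ≤ n ^ 4 * n := by gcongr
      _ = _ := by ring
  have h' : (treeClass V).ncard ≤ n ^ (11 * n) := by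
    calc _ ≤ n ^ n * (n ^ 5) ^ (n + n) := h.trans (by gcongr)
      _ = _ := by rw [← pow_mul, ← pow_add]; congr 1; ring
  rcases Nat.eq_zero_or_pos (treeClass V).ncard with h0 | h0
  · rw [h0]
    have : 0 ≤ Real.log n := Real.log_natCast_nonneg n
    simp only [Nat.cast_zero, Real.log_zero]
    positivity
  · calc Real.log (treeClass V).ncard ≤ Real.log ((n : ℝ) ^ (11 * n)) :=
        Real.log_le_log (by exact_mod_cast h0) (by exact_mod_cast h')
      _ = _ := by rw [Real.log_pow]; push_cast; ring

end Counting

/-! ### Learning a finite class by union bounds. -/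

section FiniteClasses

instance (V : Type*) [Finite V] : Finite (LabeledTriple V) :=
  Finite.of_injective (fun t => (t.anchor, t.pos, t.neg)) fun s t h => by
    simp only [Prod.mk.injEq] at h
    exact LabeledTriple.ext h.1 h.2.1 h.2.2

variable {V : Type*}

lemma errorRate_nonneg (D : Measure (LabeledTriple V)) (c : Classifier V) : 0 ≤ errorRate D c :=
  measureReal_nonneg

lemma bestErrorRate_le (D : Measure (LabeledTriple V)) {H : Set (Classifier V)} {h : Classifier V}
    (hh : h ∈ H) : bestErrorRate D H ≤ errorRate D h :=
  csInf_le ⟨0, by rintro _ ⟨c, -, rfl⟩; exact errorRate_nonneg D c⟩ ⟨h, hh, rfl⟩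

lemma bestErrorRate_nonneg (D : Measure (LabeledTriple V)) (H : Set (Classifier V)) :
    0 ≤ bestErrorRate D H :=
  Real.sInf_nonneg (by rintro _ ⟨c, -, rfl⟩; exact errorRate_nonneg D c)

lemma exists_errorRate_eq_best (D : Measure (LabeledTriple V)) {H : Set (Classifier V)}
    (hH : H.Finite) (hne : H.Nonempty) : ∃ h ∈ H, errorRate D h = bestErrorRate D H :=
  (hne.image _).csInf_mem (hH.image _)

/-- A learner succeeds if the bad events of the members of a finite class are unlikely. -/
lemma succeeds_of_bad_events [Finite V] {H : Set (Classifier V)} (hH : H.Finite) {ε δ : ℝ} {m : ℕ}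
    {A : (Fin m → LabeledTriple V) → Classifier V} {D : Measure (LabeledTriple V)}
    [IsProbabilityMeasure D] (hA : ∀ s, A s ∈ H) {q : ℝ}
    (bad : Classifier V → Set (Fin m → LabeledTriple V)) (Z : Set (Fin m → LabeledTriple V))
    (hZ : (Measure.pi fun _ : Fin m => D).real Z = 0) (hbad : ∀ s, s ∉ Z → s ∈ bad (A s))
    (hq : ∀ h ∈ H, bestErrorRate D H + ε < errorRate D h →
      (Measure.pi fun _ : Fin m => D).real (bad h) ≤ q)
    (hq0 : 0 ≤ q) (hδ : H.ncard * q ≤ δ) : Succeeds H ε δ A D := by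
  classical
  set μ := Measure.pi fun _ : Fin m => D
  let W := hH.toFinset.filter fun h => bestErrorRate D H + ε < errorRate D h
  set G := {s | errorRate D (A s) ≤ bestErrorRate D H + ε}
  have hsub : Gᶜ ⊆ Z ∪ ⋃ h ∈ W, bad h := by
    intro s hs
    by_cases hsZ : s ∈ Z
    · exact Or.inl hsZ
    · refine Or.inr (Set.mem_biUnion (x := A s) ?_ (hbad s hsZ))
      simpa [W, G, hA s] using hs
  have h1 : μ.real Gᶜ ≤ δ := by
    calc μ.real Gᶜ ≤ μ.real (Z ∪ ⋃ h ∈ W, bad h) := measureReal_mono hsub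
      _ ≤ μ.real Z + ∑ h ∈ W, μ.real (bad h) :=
        (measureReal_union_le _ _).trans (by gcongr; exact measureReal_biUnion_finset_le _ _)
      _ ≤ 0 + ∑ h ∈ W, q := by
        rw [hZ]
        gcongr with h hh
        simp only [W, Finset.mem_filter, Set.Finite.mem_toFinset] at hh
        exact hq h hh.1 hh.2
      _ = W.card * q := by simp
      _ ≤ H.ncard * q := by
        gcongr
        rw [Set.ncard_eq_toFinset_card _ hH]
        exact Finset.card_filter_le _ _
      _ ≤ δ := hδ
  have h2 := probReal_compl_eq_one_sub (μ := μ) (Set.toFinite G).measurableSet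
  change 1 - δ ≤ μ.real G
  linarith

lemma pi_real_pi {m : ℕ} (D : Measure (LabeledTriple V)) [IsProbabilityMeasure D]
    (S : Set (LabeledTriple V)) :
    (Measure.pi fun _ : Fin m => D).real (Set.univ.pi fun _ => S) = D.real S ^ m := by
  simp [Measure.real, Measure.pi_pi]

/-- The learner outputs any hypothesis consistent with the sample. One of error above `ε` is
consistent with probability at most `(1 - ε) ^ m ≤ exp (-(ε * m))`. Samples that contradict the
perfect `h₀` form a null set. -/
lemma sufficesRealizable_of_finite [Finite V] {H O : Set (Classifier V)} (hH : H.Finite)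
    (hne : H.Nonempty) (hO : H ⊆ O) {ε δ : ℝ} {m : ℕ}
    (hm : H.ncard * Real.exp (-(ε * m)) ≤ δ) : SufficesRealizable H O ε δ m := by
  have hlearn : ∀ s : Fin m → LabeledTriple V, ∃ h ∈ H,
      (∃ h' ∈ H, ∀ i, s i ∈ h'.accepts) → ∀ i, s i ∈ h.accepts := by
    intro s
    by_cases hs : ∃ h' ∈ H, ∀ i, s i ∈ h'.accepts
    · obtain ⟨h, hh, hs'⟩ := hs
      exact ⟨h, hh, fun _ => hs'⟩
    · exact ⟨hne.some, hne.some_mem, fun h => absurd h hs⟩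
  choose A hA hAs using hlearn
  refine ⟨A, fun s => hO (hA s), fun D hD ⟨h₀, hh₀, herr⟩ => ?_⟩
  have hacc : ∀ h : Classifier V, D.real h.accepts = 1 - errorRate D h := by
    intro h
    have := probReal_compl_eq_one_sub (μ := D) (s := h.accepts) trivial
    change errorRate D h = _ at this
    linarith
  refine succeeds_of_bad_events hH hA (fun h => Set.univ.pi fun _ => h.accepts)
    (Set.univ.pi fun _ => h₀.accepts)ᶜ ?_ ?_ ?_ (Real.exp_nonneg _) hm
  · rw [probReal_compl_eq_one_sub (Set.toFinite _).measurableSet, pi_real_pi, hacc, herr]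
    simp
  · intro s hs i _
    have hs' : s ∈ Set.univ.pi fun _ => h₀.accepts := not_not.1 hs
    exact hAs s ⟨h₀, hh₀, fun i => hs' i trivial⟩ i
  · intro h _ hbad
    have := bestErrorRate_nonneg D H
    rw [pi_real_pi, hacc]
    calc (1 - errorRate D h) ^ m ≤ (Real.exp (-ε)) ^ m := by
          refine pow_le_pow_left₀ (hacc h ▸ measureReal_nonneg) ?_ m
          linarith [Real.add_one_le_exp (-ε)]
      _ = _ := by rw [← Real.exp_nat_mul]; congr 1; ring

/-- The empirical number of errors of a classifier. -/
noncomputable def sampleErrors {m : ℕ} (h : Classifier V) (s : Fin m → LabeledTriple V) : ℝ :=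
  ∑ i, (h.acceptsᶜ).indicator 1 (s i)

/-- Hoeffding for the difference `f` of the error indicators: its mean is at most `-ε`, so a
nonnegative sum deviates by at least `m * ε`. -/
lemma pi_real_sampleErrors_le [Finite V] {m : ℕ} (D : Measure (LabeledTriple V))
    [IsProbabilityMeasure D] (h h' : Classifier V) {ε : ℝ} (hε : 0 ≤ ε)
    (hlt : errorRate D h' + ε ≤ errorRate D h) :
    (Measure.pi fun _ : Fin m => D).real {s | sampleErrors h s ≤ sampleErrors h' s} ≤
      Real.exp (-(ε ^ 2 / 2 * m)) := by
  let f : LabeledTriple V → ℝ := fun t => (h'.acceptsᶜ).indicator 1 t - (h.acceptsᶜ).indicator 1 t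
  have hmeas : ∀ g : LabeledTriple V → ℝ, Measurable g := fun g _ _ => trivial
  have hind : ∀ c : Classifier V, ∫ t, (c.acceptsᶜ).indicator 1 t ∂D = errorRate D c := fun c =>
    integral_indicator_one trivial
  have hint : ∀ g : LabeledTriple V → ℝ, Integrable g D := fun g => Integrable.of_finite
  have hf : ∫ t, f t ∂D = errorRate D h' - errorRate D h := by
    rw [integral_sub (hint _) (hint _), hind, hind]
  have hsub : ProbabilityTheory.HasSubgaussianMGF (fun t => f t - ∫ t, f t ∂D)
      ((‖(1 : ℝ) - (-1)‖₊ / 2) ^ 2) D := by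
    refine ProbabilityTheory.hasSubgaussianMGF_of_mem_Icc (hmeas f).aemeasurable
      (Filter.Eventually.of_forall fun t => ?_)
    simp only [f, Set.indicator, Set.mem_Icc, Pi.one_apply]
    split_ifs <;> norm_num
  -- `f` takes values in `[-1, 1]`, an interval of half-length 1.
  have hc : ((‖(1 : ℝ) - (-1)‖₊ / 2) ^ 2) = 1 := by
    ext
    norm_num
  rw [hc] at hsub
  let X : Fin m → (Fin m → LabeledTriple V) → ℝ := fun i s => f (s i) - ∫ t, f t ∂D
  have hindep : ProbabilityTheory.iIndepFun X (Measure.pi fun _ : Fin m => D) :=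
    ProbabilityTheory.iIndepFun_pi (X := fun _ t => f t - ∫ t, f t ∂D)
      fun i => (hmeas _).aemeasurable
  have hX : ∀ i ∈ Finset.univ, ProbabilityTheory.HasSubgaussianMGF (X i) 1
      (Measure.pi fun _ : Fin m => D) := by
    intro i _
    refine ProbabilityTheory.HasSubgaussianMGF.of_map (μ := Measure.pi fun _ : Fin m => D)
      (Y := fun s => s i) (X := fun t => f t - ∫ t, f t ∂D) (measurable_pi_apply i).aemeasurable ?_
    rw [(measurePreserving_eval (fun _ : Fin m => D) i).map_eq]
    exact hsub
  have hoeff := ProbabilityTheory.HasSubgaussianMGF.measure_sum_ge_le_of_iIndepFun hindep hX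
    (ε := m * ε) (by positivity)
  refine (measureReal_mono ?_).trans (hoeff.trans (Real.exp_le_exp.2 (le_of_eq ?_)))
  · intro s hs
    have hs' : sampleErrors h s ≤ sampleErrors h' s := hs
    have hsum : ∑ i, X i s = sampleErrors h' s - sampleErrors h s -
        m * (errorRate D h' - errorRate D h) := by
      simp only [X, f, hf, sampleErrors, Finset.sum_sub_distrib]
      simp [mul_sub]
    change m * ε ≤ ∑ i, X i s
    rw [hsum]
    have : (m : ℝ) * ε ≤ m * (errorRate D h - errorRate D h') := by
      gcongr
      linarith
    linarith
  · rcases Nat.eq_zero_or_pos m with rfl | hm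
    · simp
    · have : (m : ℝ) ≠ 0 := by positivity
      simp
      field_simp

/-- The empirical minimizer need only be compared with one optimal `h₀`: a bad output makes no more
empirical errors than `h₀`. -/
lemma sufficesAgnostic_of_finite [Finite V] {H O : Set (Classifier V)} (hH : H.Finite)
    (hne : H.Nonempty) (hO : H ⊆ O) {ε δ : ℝ} (hε : 0 ≤ ε) {m : ℕ}
    (hm : H.ncard * Real.exp (-(ε ^ 2 / 2 * m)) ≤ δ) : SufficesAgnostic H O ε δ m := by
  have hlearn : ∀ s : Fin m → LabeledTriple V, ∃ h ∈ H, ∀ h' ∈ H,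
      sampleErrors h s ≤ sampleErrors h' s :=
    fun s => Set.exists_min_image H (fun h => sampleErrors h s) hH hne
  choose A hA hAs using hlearn
  refine ⟨A, fun s => hO (hA s), fun D hD => ?_⟩
  obtain ⟨h₀, hh₀, herr⟩ := exists_errorRate_eq_best D hH hne
  refine succeeds_of_bad_events hH hA (fun h => {s | sampleErrors h s ≤ sampleErrors h₀ s}) ∅
    (by simp) (fun s _ => hAs s h₀ hh₀) (fun h _ hbad => ?_) (Real.exp_nonneg _) hm
  exact pi_real_sampleErrors_le D h h₀ hε (by rw [herr]; exact hbad.le)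

/-- A union bound over `N` hypotheses with an exponent that grows linearly in the sample size. -/
lemma exists_sample_size {N : ℕ} (hN : 0 < N) {γ δ : ℝ} (hγ : 0 < γ) (hδ : 0 < δ) (hδ1 : δ < 1) :
    ∃ m : ℕ, N * Real.exp (-(γ * m)) ≤ δ ∧ (m : ℝ) ≤ (Real.log N + Real.log (1 / δ)) / γ + 1 := by
  have hlogN : 0 ≤ Real.log N := Real.log_natCast_nonneg N
  have hlogδ : 0 ≤ Real.log (1 / δ) := Real.log_nonneg (by rw [le_div_iff₀ hδ]; linarith)
  refine ⟨⌈(Real.log N + Real.log (1 / δ)) / γ⌉₊, ?_, (Nat.ceil_lt_add_one (by positivity)).le⟩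
  have h := Nat.le_ceil ((Real.log N + Real.log (1 / δ)) / γ)
  rw [div_le_iff₀ hγ] at h
  have hN' : (0 : ℝ) < N := by exact_mod_cast hN
  calc N * Real.exp (-(γ * ⌈(Real.log N + Real.log (1 / δ)) / γ⌉₊))
      ≤ N * Real.exp (-(Real.log N + Real.log (1 / δ))) := by
        gcongr
        linarith
    _ = δ := by
      rw [neg_add, Real.exp_add, Real.exp_neg, Real.exp_log hN', one_div, Real.log_inv, neg_neg,
        Real.exp_log hδ]
      field_simp

end FiniteClasses

/-! ### Hellinger affinity and Assouad's lemma. -/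

section Assouad

variable {X : Type*} [Fintype X]

/-- Cauchy–Schwarz for `p * q = min p q * max p q`, with the maxima summing to at most 2. -/
lemma sq_sum_sqrt_le_two_mul_sum_min {p q : X → ℝ} (hp : ∀ x, 0 ≤ p x) (hq : ∀ x, 0 ≤ q x)
    (hp1 : ∑ x, p x = 1) (hq1 : ∑ x, q x = 1) :
    (∑ x, √(p x * q x)) ^ 2 ≤ 2 * ∑ x, min (p x) (q x) := by
  have hmin : ∀ x, 0 ≤ min (p x) (q x) := fun x => le_min (hp x) (hq x)
  have hmax : ∀ x, 0 ≤ max (p x) (q x) := fun x => le_max_of_le_left (hp x)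
  calc (∑ x, √(p x * q x)) ^ 2 = (∑ x, √(min (p x) (q x)) * √(max (p x) (q x))) ^ 2 := by
        congr 1
        refine Finset.sum_congr rfl fun x _ => ?_
        rw [← Real.sqrt_mul (hmin x), min_mul_max]
    _ ≤ (∑ x, √(min (p x) (q x)) ^ 2) * ∑ x, √(max (p x) (q x)) ^ 2 :=
      Finset.sum_mul_sq_le_sq_mul_sq _ _ _
    _ = (∑ x, min (p x) (q x)) * ∑ x, max (p x) (q x) := by
      simp only [Real.sq_sqrt (hmin _), Real.sq_sqrt (hmax _)]
    _ ≤ (∑ x, min (p x) (q x)) * 2 := by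
      refine mul_le_mul_of_nonneg_left ?_ (Finset.sum_nonneg fun x _ => hmin x)
      calc ∑ x, max (p x) (q x) ≤ ∑ x, (p x + q x) :=
            Finset.sum_le_sum fun x _ => max_le_add_of_nonneg (hp x) (hq x)
        _ = 2 := by rw [Finset.sum_add_distrib, hp1, hq1]; norm_num
    _ = _ := mul_comm _ _

lemma sum_prod_eq_one {p : X → ℝ} (hp1 : ∑ x, p x = 1) (m : ℕ) :
    ∑ s : Fin m → X, ∏ j, p (s j) = 1 := by
  rw [← Fintype.sum_pow, hp1, one_pow]

/-- Distributions whose Hellinger affinity is close to one cannot be told apart by few samples. -/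
lemma quarter_le_sum_min_prod {p q : X → ℝ} (hp : ∀ x, 0 ≤ p x) (hq : ∀ x, 0 ≤ q x)
    (hp1 : ∑ x, p x = 1) (hq1 : ∑ x, q x = 1) {κ : ℝ} (hκ : κ ≤ 1)
    (haff : 1 - κ ≤ ∑ x, √(p x * q x)) {m : ℕ} (hm : m * κ ≤ 1 / 4) :
    1 / 4 ≤ ∑ s : Fin m → X, min (∏ j, p (s j)) (∏ j, q (s j)) := by
  have h1 := sq_sum_sqrt_le_two_mul_sum_min (p := fun s : Fin m → X => ∏ j, p (s j))
    (q := fun s => ∏ j, q (s j)) (fun s => Finset.prod_nonneg fun j _ => hp _)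
    (fun s => Finset.prod_nonneg fun j _ => hq _) (sum_prod_eq_one hp1 m) (sum_prod_eq_one hq1 m)
  -- The affinity of product distributions is the product of the affinities.
  have h2 : ∑ s : Fin m → X, √((∏ j, p (s j)) * ∏ j, q (s j)) = (∑ x, √(p x * q x)) ^ m := by
    rw [Fintype.sum_pow]
    refine Finset.sum_congr rfl fun s _ => ?_
    rw [← Finset.prod_mul_distrib, Real.sqrt_prod _ fun j _ => mul_nonneg (hp _) (hq _)]
  have h3 : 3 / 4 ≤ (∑ x, √(p x * q x)) ^ m := by
    -- Bernoulli's inequality; the final bound is `(3 / 4) ^ 2 / 2 = 9 / 32 ≥ 1 / 4`.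
    calc (3 / 4 : ℝ) ≤ 1 + m * (-κ) := by linarith
      _ ≤ (1 + -κ) ^ m := one_add_mul_le_pow (by linarith) m
      _ ≤ _ := pow_le_pow_left₀ (by linarith) (by linarith) m
  rw [h2] at h1
  nlinarith

/-- **Assouad's lemma**: if flipping one coordinate of the parameter `σ` hardly changes the
distribution, then for some `σ` every estimator of `σ` from few samples is wrong in a constant
fraction of the coordinates with constant probability. -/
lemma exists_parameter_many_errors {d m : ℕ} (w : (Fin d → Bool) → X → ℝ)
    (h0 : ∀ σ x, 0 ≤ w σ x) (h1 : ∀ σ, ∑ x, w σ x = 1) {κ : ℝ} (hκ : κ ≤ 1)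
    (haff : ∀ σ i, 1 - κ ≤ ∑ x, √(w σ x * w (Function.update σ i (!σ i)) x))
    (hm : m * κ ≤ 1 / 4) (W : (Fin m → X) → Fin d → Bool → ℕ) (hW1 : ∀ s i b, W s i b ≤ 1)
    (hW : ∀ s i b, 1 ≤ W s i b + W s i (!b)) (hd : 0 < d) :
    ∃ σ, 1 / 16 ≤ ∑ s with d ≤ 16 * ∑ i, W s i (σ i), ∏ j, w σ (s j) := by
  by_contra! hcon
  let P : (Fin d → Bool) → (Fin m → X) → ℝ := fun σ s => ∏ j, w σ (s j)
  have hP : ∀ σ s, 0 ≤ P σ s := fun σ s => Finset.prod_nonneg fun j _ => h0 σ _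
  let e : (Fin d → Bool) → Fin d → ℝ := fun σ i => ∑ s, P σ s * W s i (σ i)
  -- For each sample, at least one of the two values of coordinate `i` counts as an error, so the
  -- two expected errors add up to at least the overlap of the distributions.
  have hflip : ∀ σ i, 1 / 4 ≤ e σ i + e (Function.update σ i (!σ i)) i := by
    intro σ i
    refine (quarter_le_sum_min_prod (h0 σ) (h0 (Function.update σ i (!σ i))) (h1 _) (h1 _) hκ
      (haff σ i) hm).trans ?_
    rw [← Finset.sum_add_distrib]
    refine Finset.sum_le_sum fun s _ => ?_
    rw [Function.update_self]
    change min (P σ s) (P _ s) ≤ _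
    have hmin : 0 ≤ min (P σ s) (P (Function.update σ i (!σ i)) s) := le_min (hP _ _) (hP _ _)
    calc min (P σ s) (P (Function.update σ i (!σ i)) s)
        ≤ min (P σ s) (P (Function.update σ i (!σ i)) s) *
          ((W s i (σ i) : ℝ) + W s i (!σ i)) :=
          le_mul_of_one_le_right hmin (by exact_mod_cast hW s i (σ i))
      _ ≤ _ := by
        rw [mul_add]
        gcongr
        · exact min_le_left _ _
        · exact min_le_right _ _
  -- Flipping coordinate `i` permutes the parameters, so the average over `σ` is at least half of `1
  -- / 4`.
  have hlow : ∀ i, (Fintype.card (Fin d → Bool) : ℝ) * (1 / 8) ≤ ∑ σ, e σ i := by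
    intro i
    let F : Equiv.Perm (Fin d → Bool) := Function.Involutive.toPerm
      (fun σ => Function.update σ i (!σ i)) fun σ => by simp
    have hsum : ∑ σ, e (Function.update σ i (!σ i)) i = ∑ σ, e σ i :=
      Equiv.sum_comp F fun σ => e σ i
    have := Finset.sum_le_sum fun σ (_ : σ ∈ Finset.univ) => hflip σ i
    rw [Finset.sum_add_distrib, hsum, Finset.sum_const, Finset.card_univ, nsmul_eq_mul] at this
    linarith
  -- An event of probability below `1 / 16` contributes at most `d` errors each time, its complement
  -- fewer than `d / 16`.
  have hup : ∀ σ, ∑ i, e σ i < d * (1 / 8) := by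
    intro σ
    have hd' : (0 : ℝ) < d := by exact_mod_cast hd
    calc ∑ i, e σ i = ∑ s, P σ s * ((∑ i, W s i (σ i) : ℕ) : ℝ) := by
          rw [Finset.sum_comm]
          simp [Finset.mul_sum]
      _ ≤ ∑ s, ((if d ≤ 16 * ∑ i, W s i (σ i) then P σ s else 0) * d + P σ s * (d / 16)) := by
        refine Finset.sum_le_sum fun s _ => ?_
        have hle : ((∑ i, W s i (σ i) : ℕ) : ℝ) ≤ d := by
          have : ∑ i, W s i (σ i) ≤ ∑ _i : Fin d, 1 := Finset.sum_le_sum fun i _ => hW1 s i _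
          exact_mod_cast this.trans (by simp)
        have := hP σ s
        split_ifs with hs
        · have := mul_le_mul_of_nonneg_left hle this
          have : 0 ≤ P σ s * (d / 16) := by positivity
          linarith
        · have hlt : (16 : ℝ) * ((∑ i, W s i (σ i) : ℕ) : ℝ) ≤ d := by
            exact_mod_cast (not_le.1 hs).le
          rw [zero_mul, zero_add]
          gcongr
          linarith
      _ = (∑ s with d ≤ 16 * ∑ i, W s i (σ i), P σ s) * d + d / 16 := by
        rw [Finset.sum_add_distrib, ← Finset.sum_mul, ← Finset.sum_mul, Finset.sum_filter,
          sum_prod_eq_one (h1 σ), one_mul]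
      _ < 1 / 16 * d + d / 16 := by
        gcongr
        exact hcon σ
      _ = _ := by ring
  have h2 := Finset.sum_le_sum fun i (_ : i ∈ Finset.univ) => hlow i
  have h3 := Finset.sum_lt_sum_of_nonempty Finset.univ_nonempty
    fun σ (_ : σ ∈ Finset.univ) => hup σ
  rw [Finset.sum_comm] at h2
  simp only [Finset.sum_const, Finset.card_univ, nsmul_eq_mul, Fintype.card_fin] at h2 h3
  linarith

end Assouad

/-! ### Finite distributions given by weights. -/

section Weights

variable {X : Type*} [Fintype X] [MeasurableSpace X]

/-- The measure on a finite type with given weights. -/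
noncomputable def weightedMeasure (w : X → ℝ) : Measure X :=
  ∑ x, ENNReal.ofReal (w x) • Measure.dirac x

lemma weightedMeasure_real [MeasurableSingletonClass X] {w : X → ℝ} (h0 : ∀ x, 0 ≤ w x)
    (S : Set X) : (weightedMeasure w).real S = ∑ x, S.indicator w x := by
  rw [weightedMeasure, Measure.real, Measure.finsetSum_apply, ENNReal.toReal_sum]
  · refine Finset.sum_congr rfl fun x _ => ?_
    by_cases hx : x ∈ S <;> simp [hx, h0 x]
  · intro x _
    by_cases hx : x ∈ S <;> simp [hx]

lemma isProbabilityMeasure_weightedMeasure [MeasurableSingletonClass X] {w : X → ℝ}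
    (h0 : ∀ x, 0 ≤ w x) (h1 : ∑ x, w x = 1) : IsProbabilityMeasure (weightedMeasure w) := by
  have h := weightedMeasure_real h0 Set.univ
  simp only [Set.indicator_univ, h1] at h
  refine ⟨?_⟩
  rw [Measure.real, ENNReal.toReal_eq_one_iff] at h
  exact h

lemma pi_weightedMeasure_real [MeasurableSingletonClass X] {w : X → ℝ}
    (h0 : ∀ x, 0 ≤ w x) (h1 : ∑ x, w x = 1) {m : ℕ} (S : Finset (Fin m → X)) :
    (Measure.pi fun _ : Fin m => weightedMeasure w).real (S : Set (Fin m → X)) =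
      ∑ s ∈ S, ∏ j, w (s j) := by
  classical
  have := isProbabilityMeasure_weightedMeasure h0 h1
  rw [← sum_measureReal_singleton]
  refine Finset.sum_congr rfl fun s _ => ?_
  rw [Measure.real, Measure.pi_singleton, ENNReal.toReal_prod]
  refine Finset.prod_congr rfl fun j _ => ?_
  have := weightedMeasure_real h0 {s j}
  rw [Measure.real] at this
  simp [this, Set.indicator_apply]

end Weights

/-! ### Sample lower bounds from shattered queries. -/

section LowerBound

/-- `d` queries together with one further labeled triple. -/
structure QueryFamily (V : Type*) (d : ℕ) where
  toFun : Option (Fin d × Bool) → LabeledTriple V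
  injective : Function.Injective toFun
  swap_eq : ∀ i b, (toFun (some (i, b))).swap = toFun (some (i, !b))

/-- All labelings of the queries are realized by the class, and always with the same label of the
further triple. -/
def QueryFamily.IsShattered {V : Type*} {d : ℕ} (T : QueryFamily V d)
    (H : Set (Classifier V)) : Prop :=
  ∀ σ : Fin d → Bool, ∃ h ∈ H, T.toFun none ∈ h.accepts ∧
    ∀ i, T.toFun (some (i, σ i)) ∈ h.accepts

/-- The total weight of the queries is `β`, and the label given by `σ` has bias `α`. -/
noncomputable def biasedWeight {d : ℕ} (α β : ℝ) (σ : Fin d → Bool) : Option (Fin d × Bool) → ℝ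
  -- The remaining mass lies on the further triple and carries no information about `σ`.
  | none => 1 - β
  | some (i, b) => β / d * (if b = σ i then 1 / 2 + α else 1 / 2 - α)

variable {d : ℕ} {α β : ℝ}

lemma biasedWeight_nonneg (hα : 0 ≤ α) (hα' : α ≤ 1 / 2) (hβ : 0 ≤ β) (hβ' : β ≤ 1)
    (σ : Fin d → Bool) (y : Option (Fin d × Bool)) : 0 ≤ biasedWeight α β σ y := by
  rcases y with _ | ⟨i, b⟩
  · simpa [biasedWeight] using hβ'
  · have : (0 : ℝ) ≤ if b = σ i then 1 / 2 + α else 1 / 2 - α := by split_ifs <;> linarith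
    simp only [biasedWeight]
    positivity

lemma sum_option_prod_bool (σ : Fin d → Bool) (f : Option (Fin d × Bool) → ℝ) :
    ∑ y, f y = f none + ∑ i, (f (some (i, σ i)) + f (some (i, !σ i))) := by
  rw [Fintype.sum_option, Fintype.sum_prod_type]
  congr 1
  refine Finset.sum_congr rfl fun i _ => ?_
  rw [Fintype.sum_bool]
  cases σ i
  · exact add_comm _ _
  · rfl

lemma biasedWeight_self (σ : Fin d → Bool) (i : Fin d) :
    biasedWeight α β σ (some (i, σ i)) = β / d * (1 / 2 + α) := by
  simp [biasedWeight]

lemma biasedWeight_not (σ : Fin d → Bool) (i : Fin d) :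
    biasedWeight α β σ (some (i, !σ i)) = β / d * (1 / 2 - α) := by
  simp [biasedWeight]

lemma sum_biasedWeight (hd : 0 < d) (σ : Fin d → Bool) : ∑ y, biasedWeight α β σ y = 1 := by
  have hd' : (d : ℝ) ≠ 0 := by positivity
  rw [sum_option_prod_bool σ]
  simp only [biasedWeight_self, biasedWeight_not]
  simp only [biasedWeight, Finset.sum_const, Finset.card_univ, Fintype.card_fin, nsmul_eq_mul]
  field_simp
  ring

/-- Only the two labelings of query `i` change weight. Each contributes `β / d * √(1 / 4 - α ^ 2)`,
which is at least `β / d * (1 / 2 - 2 * α ^ 2)` because `4 * α ^ 2 ≤ 1`. -/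
lemma affinity_biasedWeight (hd : 0 < d) (hα : 0 ≤ α) (hα' : α ≤ 1 / 2) (hβ : 0 ≤ β)
    (hβ' : β ≤ 1) (σ : Fin d → Bool) (i : Fin d) : 1 - 4 * α ^ 2 * β / d ≤
      ∑ y, √(biasedWeight α β σ y * biasedWeight α β (Function.update σ i (!σ i)) y) := by
  have hd' : (d : ℝ) ≠ 0 := by positivity
  have hβd : 0 ≤ β / d := by positivity
  rw [sum_option_prod_bool σ]
  have hnone : √(biasedWeight α β σ none * biasedWeight α β (Function.update σ i (!σ i)) none) =
      1 - β := Real.sqrt_mul_self (by simpa [biasedWeight] using hβ')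
  have hterm : ∀ j, β / d - (if j = i then 4 * α ^ 2 * β / d else 0) ≤
      √(biasedWeight α β σ (some (j, σ j)) *
          biasedWeight α β (Function.update σ i (!σ i)) (some (j, σ j))) +
        √(biasedWeight α β σ (some (j, !σ j)) *
          biasedWeight α β (Function.update σ i (!σ i)) (some (j, !σ j))) := by
    intro j
    by_cases hj : j = i
    · subst hj
      have e1 : biasedWeight α β (Function.update σ j (!σ j)) (some (j, σ j)) =
          β / d * (1 / 2 - α) := by simp [biasedWeight]
      have e2 : biasedWeight α β (Function.update σ j (!σ j)) (some (j, !σ j)) =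
          β / d * (1 / 2 + α) := by simp [biasedWeight]
      rw [e1, e2, biasedWeight_self, biasedWeight_not, if_pos rfl]
      have key : β / d * (1 / 2 - 2 * α ^ 2) ≤ √(β / d * (1 / 2 + α) * (β / d * (1 / 2 - α))) := by
        refine Real.le_sqrt_of_sq_le ?_
        have h4 : (1 / 2 - 2 * α ^ 2) ^ 2 ≤ (1 / 2 + α) * (1 / 2 - α) := by
          have : 4 * α ^ 2 ≤ 1 := by nlinarith
          nlinarith [sq_nonneg α]
        calc (β / d * (1 / 2 - 2 * α ^ 2)) ^ 2 = (β / d) ^ 2 * (1 / 2 - 2 * α ^ 2) ^ 2 := by ring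
          _ ≤ (β / d) ^ 2 * ((1 / 2 + α) * (1 / 2 - α)) := by gcongr
          _ = _ := by ring
      rw [mul_comm (β / d * (1 / 2 - α)) (β / d * (1 / 2 + α))]
      calc β / d - 4 * α ^ 2 * β / d = β / d * (1 / 2 - 2 * α ^ 2) + β / d * (1 / 2 - 2 * α ^ 2) := by
            ring
        _ ≤ _ := add_le_add key key
    · have e1 : biasedWeight α β (Function.update σ i (!σ i)) (some (j, σ j)) =
          β / d * (1 / 2 + α) := by simp [biasedWeight, hj]
      have e2 : biasedWeight α β (Function.update σ i (!σ i)) (some (j, !σ j)) =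
          β / d * (1 / 2 - α) := by simp [biasedWeight, hj]
      rw [e1, e2, biasedWeight_self, biasedWeight_not, if_neg hj, Real.sqrt_mul_self (by positivity),
        Real.sqrt_mul_self (mul_nonneg hβd (by linarith))]
      linarith
  have hsum := Finset.sum_le_sum fun j (_ : j ∈ Finset.univ) => hterm j
  rw [Finset.sum_sub_distrib, Finset.sum_ite_eq' Finset.univ i, if_pos (Finset.mem_univ i),
    Finset.sum_const, Finset.card_univ, Fintype.card_fin, nsmul_eq_mul, mul_div_cancel₀ _ hd'] at hsum
  rw [hnone]
  linarith

variable {V : Type*}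

namespace QueryFamily

variable (T : QueryFamily V d)

/-- The biased weights as weights of labeled triples. -/
noncomputable def weight (α β : ℝ) (σ : Fin d → Bool) : LabeledTriple V → ℝ :=
  Function.extend T.toFun (biasedWeight α β σ) 0

lemma weight_apply (σ : Fin d → Bool) (y : Option (Fin d × Bool)) :
    T.weight α β σ (T.toFun y) = biasedWeight α β σ y :=
  T.injective.extend_apply _ _ _

lemma weight_of_notMem (σ : Fin d → Bool) {t : LabeledTriple V} (ht : t ∉ Set.range T.toFun) :
    T.weight α β σ t = 0 :=
  Function.extend_apply' _ _ _ ht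

lemma weight_nonneg (hα : 0 ≤ α) (hα' : α ≤ 1 / 2) (hβ : 0 ≤ β) (hβ' : β ≤ 1)
    (σ : Fin d → Bool) (t : LabeledTriple V) : 0 ≤ T.weight α β σ t := by
  by_cases ht : t ∈ Set.range T.toFun
  · obtain ⟨y, rfl⟩ := ht
    rw [weight_apply]
    exact biasedWeight_nonneg hα hα' hβ hβ' σ y
  · rw [weight_of_notMem T σ ht]

variable [Fintype (LabeledTriple V)]

lemma sum_weight (hd : 0 < d) (σ : Fin d → Bool) : ∑ t, T.weight α β σ t = 1 := by
  rw [← sum_biasedWeight (α := α) (β := β) hd σ]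
  exact (Fintype.sum_of_injective _ T.injective _ _ (fun t ht => T.weight_of_notMem σ ht)
    fun y => (T.weight_apply σ y).symm).symm

lemma errorRate_weightedMeasure (hα : 0 ≤ α) (hα' : α ≤ 1 / 2) (hβ : 0 ≤ β) (hβ' : β ≤ 1)
    (σ : Fin d → Bool) (c : Classifier V) :
    errorRate (weightedMeasure (T.weight α β σ)) c =
      ∑ y, (T.toFun ⁻¹' c.acceptsᶜ).indicator (biasedWeight α β σ) y := by
  rw [errorRate, weightedMeasure_real (T.weight_nonneg hα hα' hβ hβ' σ)]
  refine (Fintype.sum_of_injective _ T.injective _ _ (fun t ht => ?_) fun y => ?_).symm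
  · exact Set.indicator_apply_eq_zero.2 fun _ => T.weight_of_notMem σ ht
  · by_cases hy : T.toFun y ∈ c.accepts
    · rw [Set.indicator_of_notMem (by simpa using hy), Set.indicator_of_notMem (by simpa using hy)]
    · rw [Set.indicator_of_mem (by simpa using hy), Set.indicator_of_mem (by simpa using hy),
        weight_apply]

lemma errorRate_eq_of_mem (hd : 0 < d) (hα : 0 ≤ α) (hα' : α ≤ 1 / 2) (hβ : 0 ≤ β) (hβ' : β ≤ 1)
    {σ : Fin d → Bool} {h : Classifier V} (hnone : T.toFun none ∈ h.accepts)
    (hsome : ∀ i, T.toFun (some (i, σ i)) ∈ h.accepts) :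
    errorRate (weightedMeasure (T.weight α β σ)) h = β * (1 / 2 - α) := by
  classical
  have hd' : (d : ℝ) ≠ 0 := by positivity
  have hnot : ∀ i, T.toFun (some (i, !σ i)) ∉ h.accepts := fun i =>
    T.swap_eq i (σ i) ▸ h.swap_notMem _ (hsome i)
  rw [T.errorRate_weightedMeasure hα hα' hβ hβ', sum_option_prod_bool σ]
  simp only [Set.indicator_apply, Set.mem_preimage, Set.mem_compl_iff, hnone, hsome, hnot,
    not_true_eq_false, not_false_eq_true, if_true, if_false, biasedWeight_not, Finset.sum_const,
    Finset.card_univ, Fintype.card_fin, nsmul_eq_mul]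
  field_simp
  ring

open Classical in
-- Missing the label `σ i` costs at least `β / d * (1 / 2 + α)` instead of `β / d * (1 / 2 - α)`,
-- also when no label is given.
lemma le_errorRate (hd : 0 < d) (hα : 0 ≤ α) (hα' : α ≤ 1 / 2) (hβ : 0 ≤ β) (hβ' : β ≤ 1)
    (σ : Fin d → Bool) (c : Classifier V) :
    β * (1 / 2 - α) + 2 * α * β / d *
      ((∑ i, if T.toFun (some (i, σ i)) ∈ c.accepts then 0 else 1 : ℕ) : ℝ) ≤
      errorRate (weightedMeasure (T.weight α β σ)) c := by
  have hd' : (d : ℝ) ≠ 0 := by positivity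
  have hβd : 0 ≤ β / d := by positivity
  rw [T.errorRate_weightedMeasure hα hα' hβ hβ', sum_option_prod_bool σ]
  have hnone : 0 ≤ (T.toFun ⁻¹' c.acceptsᶜ).indicator (biasedWeight α β σ) none :=
    Set.indicator_apply_nonneg fun _ => biasedWeight_nonneg hα hα' hβ hβ' σ _
  have hterm : ∀ i, β / d * (1 / 2 - α) + 2 * α * β / d *
      ((if T.toFun (some (i, σ i)) ∈ c.accepts then 0 else 1 : ℕ) : ℝ) ≤
      (T.toFun ⁻¹' c.acceptsᶜ).indicator (biasedWeight α β σ) (some (i, σ i)) +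
        (T.toFun ⁻¹' c.acceptsᶜ).indicator (biasedWeight α β σ) (some (i, !σ i)) := by
    intro i
    by_cases hi : T.toFun (some (i, σ i)) ∈ c.accepts
    · have hnot : T.toFun (some (i, !σ i)) ∉ c.accepts := T.swap_eq i (σ i) ▸ c.swap_notMem _ hi
      simp [hi, hnot, biasedWeight_not]
    · have h2 : 0 ≤ (T.toFun ⁻¹' c.acceptsᶜ).indicator (biasedWeight α β σ) (some (i, !σ i)) :=
        Set.indicator_apply_nonneg fun _ => biasedWeight_nonneg hα hα' hβ hβ' σ _
      have h1 : (T.toFun ⁻¹' c.acceptsᶜ).indicator (biasedWeight α β σ) (some (i, σ i)) =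
          β / d * (1 / 2 + α) := by
        rw [Set.indicator_of_mem (by exact hi), biasedWeight_self]
      rw [h1, if_neg hi, Nat.cast_one, mul_one]
      have : β / d * (1 / 2 - α) + 2 * α * β / d = β / d * (1 / 2 + α) := by ring
      linarith
  have hsum := Finset.sum_le_sum fun i (_ : i ∈ Finset.univ) => hterm i
  rw [Finset.sum_add_distrib, Finset.sum_const, ← Finset.mul_sum, Finset.card_univ,
    Fintype.card_fin, nsmul_eq_mul, ← mul_assoc (d : ℝ), mul_div_cancel₀ _ hd', ← Nat.cast_sum] at hsum
  linarith

/-- No learner succeeds on all biased distributions. -/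
lemma exists_not_succeeds (hd : 0 < d) (hα : 0 ≤ α) (hα' : α ≤ 1 / 2) (hβ : 0 ≤ β)
    (hβ' : β ≤ 1) {H : Set (Classifier V)} (hT : T.IsShattered H) {ε δ : ℝ}
    (hε : ε < α * β / 8) (hδ : δ < 1 / 16) {m : ℕ} (hm : m * (4 * α ^ 2 * β / d) ≤ 1 / 4)
    (A : (Fin m → LabeledTriple V) → Classifier V) :
    ∃ σ, ¬ Succeeds H ε δ A (weightedMeasure (T.weight α β σ)) := by
  classical
  have hd' : (0 : ℝ) < d := by exact_mod_cast hd
  have h0 := T.weight_nonneg hα hα' hβ hβ'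
  have h1 := T.sum_weight (α := α) (β := β) hd
  have hκ : 4 * α ^ 2 * β / d ≤ 1 := by
    rw [div_le_one hd']
    have hd1 : (1 : ℝ) ≤ d := by exact_mod_cast hd
    have h4 : 4 * α ^ 2 ≤ 1 := by nlinarith
    calc 4 * α ^ 2 * β ≤ 1 * 1 := mul_le_mul h4 hβ' hβ zero_le_one
      _ ≤ d := by linarith
  have haff : ∀ σ i, 1 - 4 * α ^ 2 * β / d ≤
      ∑ t, √(T.weight α β σ t * T.weight α β (Function.update σ i (!σ i)) t) := by
    intro σ i
    refine (affinity_biasedWeight hd hα hα' hβ hβ' σ i).trans (le_of_eq ?_)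
    refine Fintype.sum_of_injective _ T.injective _ _ (fun t ht => ?_) fun y => ?_
    · rw [T.weight_of_notMem _ ht, zero_mul, Real.sqrt_zero]
    · rw [weight_apply, weight_apply]
  obtain ⟨σ, hσ⟩ := exists_parameter_many_errors (T.weight α β) h0 h1 hκ haff hm
    (fun s i b => if T.toFun (some (i, b)) ∈ (A s).accepts then 0 else 1)
    (fun s i b => by split_ifs <;> simp)
    (fun s i b => by
      by_cases h : T.toFun (some (i, b)) ∈ (A s).accepts
      · simp [← T.swap_eq i b, (A s).swap_notMem _ h]
      · simp [h]) hd
  refine ⟨σ, fun hsucc => ?_⟩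
  have := isProbabilityMeasure_weightedMeasure (h0 σ) (h1 σ)
  set D := weightedMeasure (T.weight α β σ)
  set B : Finset (Fin m → LabeledTriple V) := Finset.univ.filter fun s =>
    d ≤ 16 * ∑ i, if T.toFun (some (i, σ i)) ∈ (A s).accepts then 0 else 1
  rw [← pi_weightedMeasure_real (h0 σ) (h1 σ)] at hσ
  have hbest : bestErrorRate D H ≤ β * (1 / 2 - α) := by
    obtain ⟨h, hh, hnone, hsome⟩ := hT σ
    exact (bestErrorRate_le D hh).trans
      (T.errorRate_eq_of_mem hd hα hα' hβ hβ' hnone hsome).le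
  have hsub : {s | errorRate D (A s) ≤ bestErrorRate D H + ε} ⊆ (B : Set _)ᶜ := by
    intro s hs hsB
    have hs' : errorRate D (A s) ≤ bestErrorRate D H + ε := hs
    have hsB' : (d : ℝ) ≤ 16 *
        ((∑ i, if T.toFun (some (i, σ i)) ∈ (A s).accepts then 0 else 1 : ℕ) : ℝ) := by
      have := (Finset.mem_filter.1 hsB).2
      exact_mod_cast this
    have hle := T.le_errorRate hd hα hα' hβ hβ' σ (A s)
    -- At least `d / 16` wrong queries cost `2 * α * β / d` each, an excess of at least `α * β / 8 >
    -- ε`.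
    have hmul : α * β / 8 ≤ 2 * α * β / d *
        ((∑ i, if T.toFun (some (i, σ i)) ∈ (A s).accepts then 0 else 1 : ℕ) : ℝ) := by
      calc α * β / 8 = 2 * α * β / d * (d / 16) := by field_simp; ring
        _ ≤ _ := by
          gcongr
          linarith
    linarith
  have hle := measureReal_mono (μ := Measure.pi fun _ : Fin m => D) hsub
  rw [probReal_compl_eq_one_sub (Set.toFinite _).measurableSet] at hle
  have : 1 - δ ≤ _ := hsucc
  linarith

end QueryFamily

/-- Bias `α = 1 / 2` removes the noise, so the distribution is realizable. Mass `β = 32 * ε` makes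
`α * β / 8 = 2 * ε`, and `m * 32 * ε / d ≤ 1 / 4` is the threshold for `m`. -/
lemma lt_of_sufficesRealizable [Finite V] {H O : Set (Classifier V)} (T : QueryFamily V d) (hd : 0 < d)
    (hT : T.IsShattered H) {ε δ : ℝ} (hε : 0 < ε) (hε' : ε ≤ 1 / 32) (hδ : δ < 1 / 16) {m : ℕ}
    (hm : SufficesRealizable H O ε δ m) : d / (128 * ε) < m := by
  classical
  have := Fintype.ofFinite (LabeledTriple V)
  by_contra! hle
  obtain ⟨A, -, hA⟩ := hm
  have hd' : (0 : ℝ) < d := by exact_mod_cast hd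
  have hα : (0 : ℝ) ≤ 1 / 2 := by norm_num
  have hβ : 0 ≤ 32 * ε := by positivity
  have hβ' : 32 * ε ≤ 1 := by linarith
  obtain ⟨σ, hσ⟩ := T.exists_not_succeeds (α := 1 / 2) (β := 32 * ε) hd hα le_rfl hβ hβ' hT
    (ε := ε) (by linarith) hδ (m := m) (by
      rw [le_div_iff₀ (by positivity)] at hle
      rw [mul_div_assoc', div_le_iff₀ hd']
      linarith) A
  obtain ⟨h, hh, hnone, hsome⟩ := hT σ
  refine hσ (hA _ (isProbabilityMeasure_weightedMeasure (T.weight_nonneg hα le_rfl hβ hβ' σ)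
    (T.sum_weight hd σ)) ⟨h, hh, ?_⟩)
  rw [T.errorRate_eq_of_mem hd hα le_rfl hβ hβ' hnone hsome]
  ring

/-- Full mass `β = 1` and bias `α = 16 * ε` again give `α * β / 8 = 2 * ε`; the threshold is `m *
1024 * ε ^ 2 / d ≤ 1 / 4`. -/
lemma lt_of_sufficesAgnostic [Finite V] {H O : Set (Classifier V)} (T : QueryFamily V d) (hd : 0 < d)
    (hT : T.IsShattered H) {ε δ : ℝ} (hε : 0 < ε) (hε' : ε ≤ 1 / 32) (hδ : δ < 1 / 16) {m : ℕ}
    (hm : SufficesAgnostic H O ε δ m) : d / (4096 * ε ^ 2) < m := by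
  classical
  have := Fintype.ofFinite (LabeledTriple V)
  by_contra! hle
  obtain ⟨A, -, hA⟩ := hm
  have hd' : (0 : ℝ) < d := by exact_mod_cast hd
  have hα : (0 : ℝ) ≤ 16 * ε := by positivity
  have hα' : 16 * ε ≤ 1 / 2 := by linarith
  obtain ⟨σ, hσ⟩ := T.exists_not_succeeds (α := 16 * ε) (β := 1) hd hα hα' zero_le_one le_rfl hT
    (ε := ε) (by linarith) hδ (m := m) (by
      rw [le_div_iff₀ (by positivity)] at hle
      rw [mul_div_assoc', div_le_iff₀ hd']
      linarith) A
  exact hσ (hA _ (isProbabilityMeasure_weightedMeasure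
    (T.weight_nonneg hα hα' zero_le_one le_rfl σ) (T.sum_weight hd σ)))

end LowerBound

/-! ### Star metrics shatter linearly many queries. -/

section Stars

open Classical in
/-- The metric of a star whose leaves are at distance `w u` from the center. -/
noncomputable def starMetric {V : Type*} (w : V → ℝ) (u v : V) : ℝ :=
  if u = v then 0 else w u + w v

lemma starMetric_of_ne {V : Type*} (w : V → ℝ) {u v : V} (h : u ≠ v) :
    starMetric w u v = w u + w v := if_neg h

lemma isMetric_starMetric {V : Type*} {w : V → ℝ} (hw : ∀ v, 0 < w v) :
    IsMetric (starMetric w) where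
  eq_zero_iff u v := by
    by_cases h : u = v
    · simp [starMetric, h]
    · simp only [starMetric, h, if_false, iff_false]
      linarith [hw u, hw v]
  symm u v := by
    by_cases h : u = v
    · rw [h]
    · rw [starMetric_of_ne w h, starMetric_of_ne w (Ne.symm h), add_comm]
  triangle u v x := by
    have := hw u
    have := hw v
    have := hw x
    simp only [starMetric]
    split_ifs <;> subst_vars <;> first | contradiction | linarith

lemma isTreeMetric_starMetric {V : Type*} [Fintype V] (hV : 3 ≤ Fintype.card V) {w : V → ℝ}
    (hw : ∀ v, 0 < w v) : IsTreeMetric (starMetric w) := by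
  classical
  set n := Fintype.card V
  let e : V ≃ Fin n := Fintype.equivFin V
  -- As `f` vanishes at the center, the edge weight `f a + f b` is the length of the ray.
  let f : Fin (n + 1) → ℝ := Fin.cases 0 fun i => w (e.symm i)
  have hleaf : ∀ a : Fin (n + 1), a ≠ 0 ↔ ((SimpleGraph.starGraph 0).neighborSet a).ncard = 1 := by
    intro a
    rw [← Nat.card_coe_set_eq, Nat.card_eq_fintype_card, SimpleGraph.card_neighborSet_eq_degree]
    constructor
    · exact SimpleGraph.degree_starGraph_of_ne_center
    · rintro h rfl
      rw [SimpleGraph.degree_starGraph_center, Fintype.card_fin] at h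
      omega
  let l : V ≃ {a : Fin (n + 1) // ((SimpleGraph.starGraph 0).neighborSet a).ncard = 1} :=
    (e.trans (finSuccAboveEquiv 0)).trans (Equiv.subtypeEquivRight hleaf)
  have hl0 : ∀ v, (l v : Fin (n + 1)) ≠ 0 := fun v => (finSuccAboveEquiv 0 (e v)).2
  have hlf : ∀ v, f (l v) = w v := fun v => by
    change Fin.cases 0 (fun i => w (e.symm i)) (Fin.succAbove 0 (e v)) = w v
    simp
  refine ⟨isMetric_starMetric hw, n + 1, SimpleGraph.starGraph 0,
    Sym2.lift ⟨fun a b => f a + f b, fun _ _ => add_comm _ _⟩, l, SimpleGraph.isTree_starGraph 0,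
    ?_, fun u v => ?_⟩
  · have hf : ∀ a, 0 ≤ f a := Fin.cases le_rfl fun i => (hw _).le
    intro x _
    induction x with
    | h a b => exact add_nonneg (hf a) (hf b)
  · by_cases huv : u = v
    · subst huv
      exact ⟨.nil, by simp, by simp [starMetric]⟩
    · have hne : (l u : Fin (n + 1)) ≠ l v := fun h => huv (l.injective (Subtype.ext h))
      refine ⟨.cons (SimpleGraph.starGraph_center_adj' (hl0 u).symm)
        (.cons (SimpleGraph.starGraph_center_adj (hl0 v).symm) .nil), ?_, ?_⟩
      · simp [SimpleGraph.Walk.cons_isPath_iff, hl0, hne, (hl0 v).symm]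
      · have hf0 : f 0 = 0 := rfl
        simp [starMetric_of_ne w huv, hlf, hf0]

lemma classifierOf_starMetric_mem {V : Type*} [Fintype V] (hV : 3 ≤ Fintype.card V) {w : V → ℝ}
    (hw : ∀ v, 0 < w v) : classifierOf (starMetric w) ∈ treeClass V :=
  ⟨_, isTreeMetric_starMetric hV hw, rfl⟩

/-- The comparisons of disjoint pairs of points as seen from a common anchor `q none`. -/
def pairQueries {V : Type*} {d : ℕ} (q : Option (Fin d × Bool) ↪ V) (i₀ : Fin d) :
    QueryFamily V d where
  toFun
    -- An anchor other than `q none` keeps this triple apart from the pair queries.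
    | none => ⟨q (some (i₀, true)), q none, q (some (i₀, false)), by simp, by simp, by simp⟩
    | some (i, b) => ⟨q none, q (some (i, b)), q (some (i, !b)), by simp, by simp, by simp⟩
  injective := by
    rintro (_ | ⟨i, b⟩) (_ | ⟨j, c⟩) h
    · rfl
    · simp [LabeledTriple.ext_iff] at h
    · simp [LabeledTriple.ext_iff] at h
    · simp only [LabeledTriple.ext_iff, q.injective.eq_iff] at h
      exact h.2.1
  swap_eq i b := by simp [LabeledTriple.swap]

/-- Edge weights of a star for which the labeling `σ` of the pair queries is the correct one. -/
noncomputable def pairWeight {d : ℕ} (σ : Fin d → Bool) : Option (Fin d × Bool) → ℝ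
  -- Below both other weights, so the further triple has the same label for every `σ`.
  | none => 1 / 2
  | some (i, b) => if b = σ i then 1 else 2

lemma isShattered_pairQueries {V : Type*} [Fintype V] (hV : 3 ≤ Fintype.card V) {d : ℕ}
    (q : Option (Fin d × Bool) ↪ V) (i₀ : Fin d) :
    (pairQueries q i₀).IsShattered (treeClass V) := by
  intro σ
  have hpos : ∀ y, 0 < pairWeight σ y := by
    rintro (_ | ⟨i, b⟩)
    · norm_num [pairWeight]
    · simp only [pairWeight]
      split_ifs <;> norm_num
  let w : V → ℝ := Function.extend q (pairWeight σ) 1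
  have hwq : ∀ y, w (q y) = pairWeight σ y := fun y => q.injective.extend_apply _ _ _
  have hw : ∀ v, 0 < w v := by
    intro v
    by_cases hv : ∃ y, q y = v
    · obtain ⟨y, rfl⟩ := hv
      rw [hwq]
      exact hpos y
    · rw [show w v = 1 from Function.extend_apply' _ _ _ hv]
      exact one_pos
  refine ⟨_, classifierOf_starMetric_mem hV hw, ?_, fun i => ?_⟩
  · change starMetric w (q (some (i₀, true))) (q none) <
      starMetric w (q (some (i₀, true))) (q (some (i₀, false)))
    rw [starMetric_of_ne _ (by simp), starMetric_of_ne _ (by simp), hwq, hwq, hwq]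
    simp only [pairWeight]
    split_ifs <;> norm_num
  · change starMetric w (q none) (q (some (i, σ i))) < starMetric w (q none) (q (some (i, !σ i)))
    rw [starMetric_of_ne _ (by simp), starMetric_of_ne _ (by simp), hwq, hwq, hwq]
    norm_num [pairWeight]

/-- One anchor and `d = (n - 1) / 2` pairs fit into `n` points; the worst case of `n ≤ 4 * d` is `n
= 4`. -/
lemma exists_isShattered (V : Type*) [Fintype V] (hV : 3 ≤ Fintype.card V) :
    ∃ (d : ℕ) (T : QueryFamily V d), 0 < d ∧ Fintype.card V ≤ 4 * d ∧
      T.IsShattered (treeClass V) := by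
  have hd : 0 < (Fintype.card V - 1) / 2 := by omega
  obtain ⟨q⟩ := Function.Embedding.nonempty_of_card_le
    (α := Option (Fin ((Fintype.card V - 1) / 2) × Bool)) (β := V) (by
      simp only [Fintype.card_option, Fintype.card_prod, Fintype.card_fin, Fintype.card_bool]
      omega)
  exact ⟨_, pairQueries q ⟨0, hd⟩, hd, by omega, isShattered_pairQueries hV q _⟩

end Stars

/-! ### Assembling the constants. -/

section Main

lemma one_le_mul_log {n : ℕ} (hn : 3 ≤ n) : 1 ≤ (n : ℝ) * Real.log n := by
  have h3 : (3 : ℝ) ≤ n := by exact_mod_cast hn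
  have h1 : 1 ≤ Real.log n := by
    rw [Real.le_log_iff_exp_le (by linarith)]
    linarith [Real.exp_one_lt_three]
  nlinarith

variable {V : Type*} [Fintype V] {O : Set (Classifier V)} {ε δ : ℝ}

lemma exists_suffices (hV : 3 ≤ Fintype.card V) (hO : treeClass V ⊆ O) (hε : 0 < ε) (hε1 : ε < 1)
    (hδ : 0 < δ) (hδ1 : δ < 1) :
    (∃ m : ℕ, SufficesRealizable (treeClass V) O ε δ m ∧
      (m : ℝ) ≤ 25 * (Fintype.card V * Real.log (Fintype.card V) / ε) *
        (1 + Real.log (1 / ε) + Real.log (1 / δ)) ^ 1) ∧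
    ∃ m : ℕ, SufficesAgnostic (treeClass V) O ε δ m ∧
      (m : ℝ) ≤ 25 * (Fintype.card V * Real.log (Fintype.card V) / ε ^ 2) *
        (1 + Real.log (1 / ε) + Real.log (1 / δ)) ^ 1 := by
  have hne : (treeClass V).Nonempty :=
    ⟨_, classifierOf_starMetric_mem hV (w := 1) fun _ => one_pos⟩
  have hfin := finite_treeClass V
  have hN : 0 < (treeClass V).ncard := (Set.ncard_pos hfin).2 hne
  have hlog := log_ncard_treeClass_le V (by omega)
  have ha := one_le_mul_log hV
  set a := (Fintype.card V : ℝ) * Real.log (Fintype.card V)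
  have hLε : 0 ≤ Real.log (1 / ε) := Real.log_nonneg (by rw [le_div_iff₀ hε]; linarith)
  have hLδ : 0 ≤ Real.log (1 / δ) := Real.log_nonneg (by rw [le_div_iff₀ hδ]; linarith)
  -- The summand `1 / 2` pays for rounding up `m`. As `a ≥ 1`, everything fits into `25 / 2 * a`,
  -- which doubles to 25 because the agnostic exponent is `ε ^ 2 / 2`.
  have hbound : 11 * a + Real.log (1 / δ) + 1 / 2 ≤
      25 / 2 * a * (1 + Real.log (1 / ε) + Real.log (1 / δ)) := by
    nlinarith [mul_nonneg (sub_nonneg.2 ha) hLε, mul_nonneg (sub_nonneg.2 ha) hLδ]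
  constructor
  · obtain ⟨m, hm, hm'⟩ := exists_sample_size hN hε hδ hδ1
    refine ⟨m, sufficesRealizable_of_finite hfin hne hO hm, hm'.trans ?_⟩
    rw [pow_one, mul_div_assoc', div_mul_eq_mul_div, div_add_one hε.ne', div_le_div_iff_of_pos_right hε]
    linarith
  · have hε2 : 0 < ε ^ 2 := by positivity
    obtain ⟨m, hm, hm'⟩ := exists_sample_size hN (half_pos hε2) hδ hδ1
    refine ⟨m, sufficesAgnostic_of_finite hfin hne hO hε.le hm, hm'.trans ?_⟩
    have hε21 : ε ^ 2 ≤ 1 := pow_le_one₀ hε.le hε1.le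
    rw [pow_one, mul_div_assoc', div_mul_eq_mul_div, div_div_eq_mul_div, div_add_one hε2.ne',
      div_le_div_iff_of_pos_right hε2]
    linarith

/-- The constant is `1 / (4 * 4096)`, from `n ≤ 4 * d` and the agnostic bound; the realizable bound
has room to spare. -/
lemma le_of_suffices (hV : 3 ≤ Fintype.card V) (hε : 0 < ε) (hε' : ε ≤ 1 / 32) (hδ : δ ≤ 1 / 32) :
    (∀ m : ℕ, SufficesRealizable (treeClass V) O ε δ m →
      1 / 16384 * ((Fintype.card V : ℝ) / ε) ≤ m) ∧
    ∀ m : ℕ, SufficesAgnostic (treeClass V) O ε δ m →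
      1 / 16384 * ((Fintype.card V : ℝ) / ε ^ 2) ≤ m := by
  obtain ⟨d, T, hd, hVd, hT⟩ := exists_isShattered V hV
  have hVd' : (Fintype.card V : ℝ) ≤ 4 * d := by exact_mod_cast hVd
  have hδ' : δ < 1 / 16 := by linarith
  constructor
  · intro m hm
    refine le_trans ?_ (lt_of_sufficesRealizable T hd hT hε hε' hδ' hm).le
    rw [mul_div_assoc', div_le_div_iff₀ hε (by positivity)]
    nlinarith
  · intro m hm
    refine le_trans ?_ (lt_of_sufficesAgnostic T hd hT hε hε' hδ' hm).le
    have hε2 : 0 < ε ^ 2 := by positivity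
    rw [mul_div_assoc', div_le_div_iff₀ hε2 (by positivity)]
    nlinarith

end Main

end TreeContrastive

/-- Sample complexity of contrastive learning for tree metrics on `n`-point data sets. The bounds
hold whether the learner has to output the classifier of a tree metric (`O = treeClass V`), may
output any classifier (`O = Set.univ`), or anything in between. -/
theorem mainTheorem5 :
    ∃ (C c ε₀ δ₀ : ℝ) (k : ℕ), 0 < C ∧ 0 < c ∧ 0 < ε₀ ∧ 0 < δ₀ ∧
      ∀ (V : Type*) [Fintype V], 3 ≤ Fintype.card V →
      ∀ O : Set (TreeContrastive.Classifier V), TreeContrastive.treeClass V ⊆ O →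
      ∀ ε δ : ℝ, 0 < ε → ε < 1 → 0 < δ → δ < 1 →
        ∃ mR mA : ℕ,
          TreeContrastive.IsRealizableSampleComplexity (TreeContrastive.treeClass V) O ε δ mR ∧
          TreeContrastive.IsAgnosticSampleComplexity (TreeContrastive.treeClass V) O ε δ mA ∧
          (mR : ℝ) ≤ C * ((Fintype.card V : ℝ) * Real.log (Fintype.card V) / ε)
            * (1 + Real.log (1 / ε) + Real.log (1 / δ)) ^ k ∧
          (mA : ℝ) ≤ C * ((Fintype.card V : ℝ) * Real.log (Fintype.card V) / ε ^ 2)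
            * (1 + Real.log (1 / ε) + Real.log (1 / δ)) ^ k ∧
          (ε ≤ ε₀ → δ ≤ δ₀ →
            c * ((Fintype.card V : ℝ) / ε) ≤ (mR : ℝ) ∧
            c * ((Fintype.card V : ℝ) / ε ^ 2) ≤ (mA : ℝ)) := by
  refine ⟨25, 1 / 16384, 1 / 32, 1 / 32, 1, by norm_num, by norm_num, by norm_num, by norm_num, ?_⟩
  intro V _ hV O hO ε δ hε hε1 hδ hδ1
  obtain ⟨⟨m₁, hm₁, hb₁⟩, m₂, hm₂, hb₂⟩ :=
    TreeContrastive.exists_suffices hV hO hε hε1 hδ hδ1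
  have hR := Nat.sInf_mem (s := {m | TreeContrastive.SufficesRealizable
    (TreeContrastive.treeClass V) O ε δ m}) ⟨m₁, hm₁⟩
  have hA := Nat.sInf_mem (s := {m | TreeContrastive.SufficesAgnostic
    (TreeContrastive.treeClass V) O ε δ m}) ⟨m₂, hm₂⟩
  refine ⟨_, _, ⟨hR, fun _ h => Nat.sInf_le h⟩, ⟨hA, fun _ h => Nat.sInf_le h⟩,
    le_trans (Nat.cast_le.2 (Nat.sInf_le hm₁)) hb₁, le_trans (Nat.cast_le.2 (Nat.sInf_le hm₂)) hb₂,
    fun hε' hδ' => ?_⟩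
  have h := TreeContrastive.le_of_suffices (O := O) hV hε hε' hδ'
  exact ⟨h.1 _ hR, h.2 _ hA⟩
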